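/- **Setting.** In both theories the elementary non-trivial systems are labelled by integers $n\ge 2$, a general system is a finite string $A=n_1\cdots n_p$ of them, the empty string $I$ is the trivial system, and parallel composition of systems is concatenation. Bits are added modulo $2$ ($\oplus$). *Classical theory (CT).* Transformations $n_1\cdots n_p\to m_1\cdots m_q$ are the substochastic matrices from $\mathbb R^{n_1}\otimes\cdots\otimes\mathbb R^{n_p}$ to $\mathbb R^{m_1}\otimes\cdots\otimes\mathbb R^{m_q}$, with matrix multiplication, tensor product and the usual swaps. The deterministic effect is the all-ones row; a finite family is an instrument iff its sum is a stochastic matrix. *Bilocal classical theory (BCT).* The pure states of $n_1\boxtimes\cdots\boxtimes n_p$ ($p\ge1$) are $((\cdots((i_1i_2)_{s_1}i_3)_{s_2}\cdots)i_p)_{s_{p-1}}$ with $1\le i_k\le n_k$, $s_k\in\{0,1\}$; the trivial system has one pure state. $\mathrm{St}_{\mathbb R}(A)$ is the real vector space with the pure states of $A$ as basis. For $A,E$ non-trivial the pure states of $A\boxtimes E$ are $(a\,e)_s$, with the identification $((a\,b)_s\,c)_t=(a\,(b\,c)_{s\oplus t})_s$ for composites; if one of the systems is trivial, there is no bit. A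 transformation $t:A\to B$ is a family of linear maps $t_E:\mathrm{St}_{\mathbb R}(A\boxtimes E)\to\mathrm{St}_{\mathbb R}(B\boxtimes E)$, one for each system $E$, which sends states (subnormalised distributions on pure states) to states and is a conical combination of - (for $A,B\neq I$) normalised atomic transformations $\mathscr A_{x}^{y,\tau}$: $|(a\,e)_s)\mapsto\delta_{a,x}|(y\,e)_{s\oplus\tau})$, where $x,y$ are pure states of $A$ and $B$ and $\tau\in\{0,1\}$; - (for $B=I$) pure effects $(x|$: $|(a\,e)_s)\mapsto\delta_{a,x}|e)$; - (for $A=I$) pure states $|y)$: $|e)\mapsto\frac12\sum_{s}|(y\,e)_s)$; - (for $A=B=I$) the scalar $1$, i.e. the identity. Sequential composition is composition of families; the swap is $|((a\,b)_s\,e)_t)\mapsto|((b\,a)_s\,e)_{s\oplus t})$; $(t\boxtimes I_C)_E=t_{C\boxtimes E}$, and $t\boxtimes u=(I\boxtimes u)\circ(t\boxtimes I)$ with $I\boxtimes u$ the conjugate of $u\boxtimes I$ by swaps. The deterministic effect of $A$ is $\sum_x(x|$; a finite family of transformations is an instrument iff its sum preserves the deterministic effect. A map $\xi$ from BCT to CT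 sends systems to systems, with $\xi(I)=I$, and transformations $A\to B$ to transformations $\xi(A)\to\xi(B)$. It is *linear* if $\xi(\sum_k r_kt_k)=\sum_k r_k\xi(t_k)$ for all real $r_k$ and all finite families of transformations $t_k:A\to B$ such that $\sum_k r_kt_k$ is a transformation. It is *diagram-preserving* if it preserves composite systems, sequential and parallel composition, identities and swaps, and *probability-preserving* if $\xi(p)=p$ for every scalar $p$. An *ontological model* of BCT is a linear, diagram-preserving, probability-preserving map from BCT to CT that sends every instrument to an instrument. **Theorem 1.** Bilocal classical theory admits an ontological model. More precisely, send each $n\ge2$ to the classical system of dimension $2n$, viewed as $n$ tensored with a bit, and $n_1\boxtimes\cdots\boxtimes n_p$ to the composite of the classical systems $2n_1,\dots,2n_p$. For a pure state $x=((\cdots(i_1i_2)_{s_1}\cdots)i_p)_{s_{p-1}}$ and a bit $b$ let $$|x;b)=|i_1,b)\otimes|i_2,b\oplus s_1)\otimes\cdots\otimes|i_p,b\oplus s_{p-1})$$ ($b$ is copied to all subsystems and NOT gates controlled by the $s_k$ are applied; for the trivial system this is the scalar $1$). Then there is exactly one linear map $\tilde\xi$ with this action on systems such that, for all pure states $x,y$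 of systems, $$\tilde\xi\big(|y)\big)=\tfrac12\sum_{b}|y;b),\qquad \tilde\xi\big((x|\big)=\sum_b (x;b|,\qquad \tilde\xi\big(\mathscr A_x^{y,\tau}\big)=\sum_b|y;b\oplus\tau)(x;b|$$ (the first formula for systems $B\ne I$, the second for $A\neq I$, the third for $A,B\ne I$), and $\tilde\xi(1)=1$. This map $\tilde\xi$ is an ontological model of BCT, and it sends deterministic effects to deterministic effects. -/

import Mathlib

open scoped NNReal Kronecker

noncomputable section

namespace BilocalClassical

/-- A bit; addition in `Fin 2` is addition modulo two. -/
abbrev Bit : Type := Fin 2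

/-- Elementary non-trivial systems are labelled by their dimension `n ≥ 2`. -/
abbrev Elem : Type := {n : ℕ // 2 ≤ n}

/-- Systems of either theory: the free monoid on the elementary systems.  The empty list is the
trivial system, and concatenation is parallel composition of systems. -/
abbrev Sys : Type := List Elem

/-! ### Classical theory -/

/-- The pure states of the classical system `n₁ n₂ ⋯ n_p`: tuples `(i₁, …, i_p)`. -/
def CPure : Sys → Type
  | [] => Unit
  | n :: l => Fin n.1 × CPure l

instance CPure.fintype : (A : Sys) → Fintype (CPure A)
  | [] => inferInstanceAs (Fintype Unit)
  | n :: l => @instFintypeProd (Fin n.1) (CPure l) _ (CPure.fintype l)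

instance CPure.decEq : (A : Sys) → DecidableEq (CPure A)
  | [] => inferInstanceAs (DecidableEq Unit)
  | n :: l => @instDecidableEqProd (Fin n.1) (CPure l) _ (CPure.decEq l)

/-- A tuple for `AB` is a tuple for `A` together with a tuple for `B`. -/
def CPure.split : (A B : Sys) → CPure (A ++ B) ≃ CPure A × CPure B
  | [], B => (Equiv.punitProd (CPure B)).symm
  | n :: l, B =>
      ((Equiv.refl (Fin n.1)).prodCongr (CPure.split l B)).trans
        (Equiv.prodAssoc (Fin n.1) (CPure l) (CPure B)).symm

/-- Transformations of classical theory from `A` to `B`: substochastic matrices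
(columns are indexed by the input, rows by the output). -/
@[ext] structure CTransf (A B : Sys) where
  mat : Matrix (CPure B) (CPure A) ℝ
  nonneg : ∀ y x, 0 ≤ mat y x
  sum_le : ∀ x, ∑ y, mat y x ≤ 1

namespace CTransf

/-- Sequential composition: first `t`, then `u`. -/
def comp {A B C : Sys} (u : CTransf B C) (t : CTransf A B) : CTransf A C where
  mat := u.mat * t.mat
  nonneg y x := Finset.sum_nonneg fun z _ => mul_nonneg (u.nonneg y z) (t.nonneg z x)
  sum_le x := by
    simp only [Matrix.mul_apply]
    rw [Finset.sum_comm]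
    refine le_trans (Finset.sum_le_sum fun z _ => ?_) (t.sum_le x)
    rw [← Finset.sum_mul]
    exact mul_le_of_le_one_left (t.nonneg z x) (u.sum_le z)

/-- Parallel composition: the tensor (Kronecker) product. -/
def par {A B C D : Sys} (t : CTransf A B) (u : CTransf C D) :
    CTransf (A ++ C) (B ++ D) where
  mat := (t.mat ⊗ₖ u.mat).submatrix (CPure.split B D) (CPure.split A C)
  nonneg y x := mul_nonneg (t.nonneg _ _) (u.nonneg _ _)
  sum_le x := by
    simp only [Matrix.submatrix_apply]
    rw [(CPure.split B D).sum_comp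
      (fun p => (t.mat ⊗ₖ u.mat) p (CPure.split A C x)), Fintype.sum_prod_type]
    simp only [Matrix.kroneckerMap_apply, ← Finset.mul_sum]
    rw [← Finset.sum_mul]
    exact mul_le_one₀ (t.sum_le _) (Finset.sum_nonneg fun z _ => u.nonneg _ _) (u.sum_le _)

/-- The identity. -/
def id (A : Sys) : CTransf A A where
  mat := 1
  nonneg y x := by rw [Matrix.one_apply]; split_ifs <;> norm_num
  sum_le x := by simp [Matrix.one_apply]

/-- The swap, `|i)|j) ↦ |j)|i)`. -/
def swap (A B : Sys) : CTransf (A ++ B) (B ++ A) where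
  mat y x := if CPure.split B A y = (CPure.split A B x).swap then 1 else 0
  nonneg y x := by split_ifs <;> norm_num
  sum_le x := by
    rw [(CPure.split B A).sum_comp
      (fun p => if p = (CPure.split A B x).swap then (1 : ℝ) else 0)]
    simp

/-- The deterministic effect: the row vector with all entries `1`. -/
def discard (A : Sys) : CTransf A [] where
  mat _ _ := 1
  nonneg _ _ := zero_le_one
  sum_le _ := le_of_eq (Fintype.sum_unique (ι := Unit) _)

/-- Transport along equalities of systems. -/
def cast {A A' B B' : Sys} (hA : A = A') (hB : B = B') (t : CTransf A B) : CTransf A' B' :=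
  hA ▸ hB ▸ t

/-- A finite family of transformations is an instrument if its sum is a stochastic matrix. -/
def IsInstrument {A B : Sys} {X : Type} [Fintype X] (t : X → CTransf A B) : Prop :=
  ∀ x, ∑ y, (∑ k, (t k).mat) y x = 1

end CTransf

/-! ### Bilocal classical theory: pure states -/

/-- The part of a pure state that is carried by the subsystems after the first one: an index and
a bit for each of them. -/
def Tail : Sys → Type
  | [] => Unit
  | n :: l => (Fin n.1 × Bit) × Tail l

/-- The pure states `((⋯((i₁ i₂)_{s₁} i₃)_{s₂} ⋯) i_p)_{s_{p-1}}` of the system `n₁ ⊠ ⋯ ⊠ n_p`,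
stored as `(i₁, (i₂, s₁), (i₃, s₂), …, (i_p, s_{p-1}))`.  The trivial system has one pure state. -/
def BPure : Sys → Type
  | [] => Unit
  | n :: l => Fin n.1 × Tail l

instance Tail.fintype : (A : Sys) → Fintype (Tail A)
  | [] => inferInstanceAs (Fintype Unit)
  | n :: l => @instFintypeProd (Fin n.1 × Bit) (Tail l) _ (Tail.fintype l)

instance Tail.decEq : (A : Sys) → DecidableEq (Tail A)
  | [] => inferInstanceAs (DecidableEq Unit)
  | n :: l => @instDecidableEqProd (Fin n.1 × Bit) (Tail l) _ (Tail.decEq l)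

instance BPure.fintype : (A : Sys) → Fintype (BPure A)
  | [] => inferInstanceAs (Fintype Unit)
  | n :: l => @instFintypeProd (Fin n.1) (Tail l) _ (Tail.fintype l)

instance BPure.decEq : (A : Sys) → DecidableEq (BPure A)
  | [] => inferInstanceAs (DecidableEq Unit)
  | n :: l => @instDecidableEqProd (Fin n.1) (Tail l) _ (Tail.decEq l)

/-- Concatenation. -/
def Tail.append : {l k : Sys} → Tail l → Tail k → Tail (l ++ k)
  | [], _, _, v => v
  | _ :: _, _, (p, u), v => (p, Tail.append u v)

/-- Add a bit to every bit. -/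
def Tail.shift : {l : Sys} → Bit → Tail l → Tail l
  | [], _, _ => ()
  | _ :: _, s, ((j, r), u) => ((j, s + r), Tail.shift s u)

/-- How the subsystems of a pure state `e` of `E` continue the left-nested expression of `x` in
the pure state `(x e)_s`.  It is obtained by iterating
`(x (j k)_r)_s = ((x j)_s k)_{s ⊕ r}`. -/
def BPure.attach : {E : Sys} → BPure E → Bit → Tail E
  | [], _, _ => ()
  | _ :: _, (j, v), s => ((j, s), Tail.shift s v)

/-- The pure state `(a e)_s` of `A ⊠ E`.  If `A` or `E` is trivial there is no bit, and `s` is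
ignored. -/
def BPure.join : {A E : Sys} → BPure A → BPure E → Bit → BPure (A ++ E)
  | [], _, _, e, _ => e
  | _ :: _, _, (i, u), e, s => (i, Tail.append u (e.attach s))

/-- `(AC)E` and `A(CE)` are the same system; this is the resulting identification of the
left-nested expressions. -/
def Tail.assoc : (A C E : Sys) → Tail ((A ++ C) ++ E) ≃ Tail (A ++ (C ++ E))
  | [], _, _ => Equiv.refl _
  | n :: l, C, E => (Equiv.refl (Fin n.1 × Bit)).prodCongr (Tail.assoc l C E)

/-- `(AC)E` and `A(CE)` are the same system; this is the resulting identification of the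
left-nested expressions. -/
def BPure.assoc : (A C E : Sys) → BPure ((A ++ C) ++ E) ≃ BPure (A ++ (C ++ E))
  | [], _, _ => Equiv.refl _
  | n :: l, C, E => (Equiv.refl (Fin n.1)).prodCongr (Tail.assoc l C E)

/-! ### Bilocal classical theory: transformations

`St_ℝ(A)` is the real vector space with the pure states of `A` as a basis.  A transformation `t`
from `A` to `B` is given by the linear maps `t_E : St_ℝ(A ⊠ E) → St_ℝ(B ⊠ E)` for all ancillary
systems `E`, here written as matrices in the bases of pure states. -/

/-- Families of linear maps `St_ℝ(A ⊠ E) → St_ℝ(B ⊠ E)`. -/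
abbrev Fam (A B : Sys) : Type := (E : Sys) → Matrix (BPure (B ++ E)) (BPure (A ++ E)) ℝ

namespace Fam

/-- The pure state `y` of `B`, in parallel with an ancilla:
`|e) ↦ |y) ⊠ |e) = ½ ∑_s |(y e)_s)`. -/
def state {B : Sys} (y : BPure B) : Fam [] B := fun _ y' e =>
  (1 / 2) * ∑ s : Bit, if y' = y.join e s then 1 else 0

open Classical in
/-- The pure effect `x` of `A`, in parallel with an ancilla:
`|(x' e)_s) ↦ δ_{x',x} |e)`. -/
def effect {A : Sys} (x : BPure A) : Fam A [] := fun E e x' =>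
  if ∃ s : Bit, x' = x.join (E := E) e s then 1 else 0

open Classical in
/-- The normalised atomic transformation `𝒜_x^{y,τ}` between non-trivial systems, in parallel
with an ancilla: `|(x' e)_s) ↦ δ_{x',x} |(y e)_{s ⊕ τ})`. -/
def atomic {n m : Elem} {l k : Sys} (x : BPure (n :: l)) (y : BPure (m :: k)) (τ : Bit) :
    Fam (n :: l) (m :: k) := fun E y' x' =>
  if ∃ (e : BPure E) (s : Bit), x' = x.join e s ∧ y' = y.join e (s + τ) then 1 else 0

/-- Sequential composition: first `t`, then `u`. -/
def comp {A B C : Sys} (u : Fam B C) (t : Fam A B) : Fam A C := fun E => u E * t E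

/-- The identity. -/
def id (A : Sys) : Fam A A := fun _ => 1

open Classical in
/-- The swap, `|((a b)_s e)_t) ↦ |((b a)_s e)_{s ⊕ t})`.  If `A` or `B` is trivial there is no
bit `s`, and the swap is the identity; this is the case `s = 0` of the formula. -/
def swap (A B : Sys) : Fam (A ++ B) (B ++ A) := fun E y' x' =>
  if ∃ (a : BPure A) (b : BPure B) (e : BPure E) (s t : Bit), (A = [] ∨ B = [] → s = 0) ∧
    x' = (a.join b s).join e t ∧ y' = (b.join a s).join e (s + t) then 1 else 0

/-- `t ⊠ I_C`. -/
def parId {A B : Sys} (t : Fam A B) (C : Sys) : Fam (A ++ C) (B ++ C) := fun E =>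
  (t (C ++ E)).submatrix (BPure.assoc B C E) (BPure.assoc A C E)

/-- Parallel composition, `t ⊠ u = (I ⊠ u) ∘ (t ⊠ I)`, where `I ⊠ u` is `u ⊠ I` conjugated by
swaps. -/
def par {A B C D : Sys} (t : Fam A B) (u : Fam C D) : Fam (A ++ C) (B ++ D) :=
  ((swap D B).comp ((u.parId B).comp (swap B C))).comp (t.parId C)

/-- The deterministic effect `∑_x (x|`. -/
def discard (A : Sys) : Fam A [] := ∑ x : BPure A, effect x

/-- Pure states, pure effects (including the scalar `1` in both cases) and normalised atomic
transformations. -/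
inductive IsGenerator : (A B : Sys) → Fam A B → Prop
  | state {B : Sys} (y : BPure B) : IsGenerator [] B (state y)
  | effect {A : Sys} (x : BPure A) : IsGenerator A [] (effect x)
  | atomic {n m : Elem} {l k : Sys} (x : BPure (n :: l)) (y : BPure (m :: k)) (τ : Bit) :
      IsGenerator (n :: l) (m :: k) (atomic x y τ)

/-- The conical combinations of pure states, pure effects and normalised atomic
transformations. -/
def cone (A B : Sys) : Submodule ℝ≥0 (Fam A B) :=
  Submodule.span ℝ≥0 {t | IsGenerator A B t}

end Fam

/-! #### Closure of the transformations under the two compositions -/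

theorem bit_add_self : ∀ s : Bit, s + s = 0 := by decide

theorem ite_equiv {α β : Type} [DecidableEq α] [DecidableEq β] (f : α ≃ β) (y z : α) :
    (if f y = f z then (1 : ℝ) else 0) = if y = z then 1 else 0 := by
  simp only [f.apply_eq_iff_eq]

theorem Tail.append_surj : ∀ {l k : Sys} (w : Tail (l ++ k)), ∃ u v, w = Tail.append (l := l) u v
  | [], _, w => ⟨(), w, rfl⟩
  | _ :: _, _, (p, w) => by
      obtain ⟨u, v, h⟩ := Tail.append_surj w
      exact ⟨(p, u), v, by rw [h]; rfl⟩

theorem Tail.append_inj : ∀ {l k : Sys} {u u' : Tail l} {v v' : Tail k},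
    Tail.append u v = Tail.append u' v' → u = u' ∧ v = v'
  | [], _, (), (), _, _, h => ⟨rfl, h⟩
  | _ :: _, _, (p, u), (p', u'), v, v', h => by
      have h1 : p = p' := congrArg Prod.fst h
      have h2 := Tail.append_inj (u := u) (u' := u') (v := v) (v' := v') (congrArg Prod.snd h)
      exact ⟨by rw [h1, h2.1], h2.2⟩

theorem Tail.shift_shift : ∀ {l : Sys} (s t : Bit) (u : Tail l),
    Tail.shift s (Tail.shift t u) = Tail.shift (s + t) u
  | [], _, _, _ => rfl
  | _ :: _, s, t, ((j, r), u) => by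
      change ((j, s + (t + r)), Tail.shift s (Tail.shift t u)) =
        ((j, s + t + r), Tail.shift (s + t) u)
      rw [Tail.shift_shift, add_assoc]

theorem Tail.shift_zero : ∀ {l : Sys} (u : Tail l), Tail.shift 0 u = u
  | [], _ => rfl
  | _ :: _, ((j, r), u) => by
      change ((j, 0 + r), Tail.shift 0 u) = ((j, r), u)
      rw [Tail.shift_zero, zero_add]

theorem Tail.shift_append : ∀ {l k : Sys} (s : Bit) (u : Tail l) (v : Tail k),
    Tail.shift s (Tail.append u v) = Tail.append (Tail.shift s u) (Tail.shift s v)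
  | [], _, _, _, _ => rfl
  | _ :: _, _, s, ((j, r), u), v => by
      change ((j, s + r), Tail.shift s (Tail.append u v)) =
        ((j, s + r), Tail.append (Tail.shift s u) (Tail.shift s v))
      rw [Tail.shift_append]

theorem Tail.assoc_append : ∀ {l C E : Sys} (u : Tail l) (v : Tail C) (w : Tail E),
    Tail.assoc l C E (Tail.append (Tail.append u v) w) = Tail.append u (Tail.append v w)
  | [], _, _, _, _, _ => rfl
  | _ :: l, C, E, (p, u), v, w => by
      change (p, Tail.assoc l C E (Tail.append (Tail.append u v) w)) =
        (p, Tail.append u (Tail.append v w))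
      rw [Tail.assoc_append]

theorem BPure.attach_shift : ∀ {E : Sys} (e : BPure E) (s t : Bit),
    Tail.shift s (e.attach t) = e.attach (s + t)
  | [], _, _, _ => rfl
  | _ :: _, (j, v), s, t => by
      change ((j, s + t), Tail.shift s (Tail.shift t v)) = ((j, s + t), Tail.shift (s + t) v)
      rw [Tail.shift_shift]

theorem BPure.attach_surj : ∀ {E : Sys} (w : Tail E), ∃ (e : BPure E) (s : Bit), w = e.attach s
  | [], _ => ⟨(), 0, rfl⟩
  | _ :: _, ((j, s), v) => ⟨(j, Tail.shift s v), s, by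
      change _ = ((j, s), Tail.shift s (Tail.shift s v))
      rw [Tail.shift_shift, bit_add_self, Tail.shift_zero]⟩

theorem BPure.attach_inj : ∀ {E : Sys} {e e' : BPure E} {s s' : Bit},
    e.attach s = e'.attach s' → e = e' ∧ (E = [] ∨ s = s')
  | [], _, _, _, _, _ => ⟨rfl, Or.inl rfl⟩
  | _ :: _, (j, v), (j', v'), s, s', h => by
      have h1 : (j, s) = (j', s') := congrArg Prod.fst h
      have h2 : Tail.shift s v = Tail.shift s' v' := congrArg Prod.snd h
      obtain ⟨rfl, rfl⟩ := Prod.ext_iff.1 h1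
      have h3 := congrArg (Tail.shift s) h2
      rw [Tail.shift_shift, Tail.shift_shift, bit_add_self,
        Tail.shift_zero, Tail.shift_zero] at h3
      exact ⟨by rw [h3], Or.inr rfl⟩

theorem BPure.join_surj : ∀ {A E : Sys} (x : BPure (A ++ E)),
    ∃ (a : BPure A) (e : BPure E) (s : Bit), x = a.join e s
  | [], _, x => ⟨(), x, 0, rfl⟩
  | _ :: _, _, (i, w) => by
      obtain ⟨u, v, rfl⟩ := Tail.append_surj w
      obtain ⟨e, s, rfl⟩ := BPure.attach_surj v
      exact ⟨(i, u), e, s, rfl⟩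

theorem BPure.join_inj : ∀ {A E : Sys} {a a' : BPure A} {e e' : BPure E} {s s' : Bit},
    a.join e s = a'.join e' s' → a = a' ∧ e = e' ∧ (A = [] ∨ E = [] ∨ s = s')
  | [], _, _, _, _, _, _, _, h => ⟨rfl, h, Or.inl rfl⟩
  | _ :: _, _, (i, u), (i', u'), e, e', s, s', h => by
      have h1 : i = i' := congrArg Prod.fst h
      have h2 := Tail.append_inj (u := u) (u' := u') (congrArg Prod.snd h)
      have h3 := BPure.attach_inj h2.2
      exact ⟨by rw [h1, h2.1], h3.1, Or.inr h3.2⟩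

theorem BPure.join_triv {A E : Sys} (h : A = [] ∨ E = []) (a : BPure A) (e : BPure E)
    (s s' : Bit) : a.join e s = a.join e s' := by
  rcases h with rfl | rfl
  · rfl
  · cases A <;> rfl

theorem BPure.assoc_join {n m : Elem} {l k E : Sys} (a : BPure (n :: l)) (c : BPure (m :: k))
    (e : BPure E) (s t : Bit) :
    BPure.assoc (n :: l) (m :: k) E ((a.join c s).join e t) = a.join (c.join e (s + t)) s := by
  obtain ⟨i, u⟩ := a
  obtain ⟨j, v⟩ := c
  refine congrArg (Prod.mk i)
    ((Tail.assoc_append u (C := m :: k) ((j, s), Tail.shift s v) (e.attach t)).trans ?_)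
  have h : Tail.append (Tail.shift s v) (e.attach t) =
      Tail.shift s (Tail.append v (e.attach (s + t))) := by
    rw [Tail.shift_append, BPure.attach_shift, ← add_assoc, bit_add_self, zero_add]
  exact congrArg (fun w => Tail.append u (k := (m :: k) ++ E) ((j, s), w)) h

theorem BPure.assoc_join_nil {A E : Sys} (a : BPure A) (e : BPure E) (r t : Bit) :
    BPure.assoc A [] E ((a.join (E := []) () r).join e t) = a.join (E := [] ++ E) e t := by
  cases A with
  | nil => rfl
  | cons n l =>
    obtain ⟨i, u⟩ := a
    exact congrArg (Prod.mk i) (Tail.assoc_append u (C := []) () (e.attach t))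

namespace Fam

theorem ext_join {A B : Sys} {t u : Fam A B}
    (h : ∀ E y (a : BPure A) (e : BPure E) s, t E y (a.join e s) = u E y (a.join e s)) :
    t = u := by
  funext E
  ext y x
  obtain ⟨a, e, s, rfl⟩ := BPure.join_surj x
  exact h E y a e s

theorem effect_join {A E : Sys} (x a : BPure A) (e : BPure E) (s : Bit) (y : BPure E) :
    effect x E y (a.join e s) = if a = x ∧ y = e then 1 else 0 := by
  unfold effect
  congr 1
  refine propext ⟨?_, ?_⟩
  · rintro ⟨s', h⟩
    have := BPure.join_inj h
    exact ⟨this.1, this.2.1.symm⟩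
  · rintro ⟨rfl, rfl⟩
    exact ⟨s, rfl⟩

theorem atomic_join {n m : Elem} {l k E : Sys} (x a : BPure (n :: l)) (y : BPure (m :: k))
    (τ : Bit) (e : BPure E) (s : Bit) (y' : BPure ((m :: k) ++ E)) :
    atomic x y τ E y' (a.join e s) = if a = x ∧ y' = y.join e (s + τ) then 1 else 0 := by
  unfold atomic
  congr 1
  refine propext ⟨?_, ?_⟩
  · rintro ⟨e', s', h, rfl⟩
    obtain ⟨rfl, rfl, h | rfl | rfl⟩ := BPure.join_inj h
    · cases h
    · exact ⟨rfl, BPure.join_triv (Or.inr rfl) _ _ _ _⟩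
    · exact ⟨rfl, rfl⟩
  · rintro ⟨rfl, rfl⟩
    exact ⟨e, s, rfl, rfl⟩

/-- Criterion for membership in the cone, input and output non-trivial. -/
theorem mem_cone_atomic {n m : Elem} {l k : Sys} (t : Fam (n :: l) (m :: k))
    (h : ∀ x : BPure (n :: l), ∃ C : BPure (m :: k) → Bit → ℝ≥0, ∀ E (e : BPure E) s y',
      t E y' (x.join e s) = ∑ y, ∑ τ, C y τ * if y' = y.join e (s + τ) then (1 : ℝ) else 0) :
    t ∈ cone (n :: l) (m :: k) := by
  choose C hC using h
  have : t = ∑ x, ∑ y, ∑ τ, C x y τ • atomic x y τ := by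
    refine ext_join fun E y' a e s => ?_
    rw [hC]
    simp only [Finset.sum_apply, Matrix.sum_apply, Pi.smul_apply, Matrix.smul_apply, atomic_join,
      NNReal.smul_def, smul_eq_mul]
    rw [Finset.sum_eq_single a]
    · simp
    · intro b _ hb
      simp [hb.symm]
    · simp
  rw [this]
  exact Submodule.sum_mem _ fun x _ => Submodule.sum_mem _ fun y _ => Submodule.sum_mem _
    fun τ _ => Submodule.smul_mem _ _ (Submodule.subset_span (IsGenerator.atomic x y τ))

/-- Criterion for membership in the cone, input and output non-trivial. -/
theorem mem_cone_atomic' {n m : Elem} {l k : Sys} (t : Fam (n :: l) (m :: k))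
    (h : ∀ x : BPure (n :: l), ∃ (c : ℝ≥0) (y : BPure (m :: k)) (τ : Bit), ∀ E (e : BPure E) s y',
      t E y' (x.join e s) = c * if y' = y.join e (s + τ) then (1 : ℝ) else 0) :
    t ∈ cone (n :: l) (m :: k) := by
  refine mem_cone_atomic t fun x => ?_
  obtain ⟨c, y, τ, h⟩ := h x
  refine ⟨fun w ρ => if w = y ∧ ρ = τ then c else 0, fun E e s y' => ?_⟩
  rw [h, Finset.sum_eq_single y, Finset.sum_eq_single τ]
  · simp
  · intro b _ hb
    simp [hb]
  · simp
  · intro b _ hb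
    simp [hb]
  · simp

/-- Criterion for membership in the cone, output trivial. -/
theorem mem_cone_effect {A : Sys} (t : Fam A [])
    (h : ∀ x : BPure A, ∃ c : ℝ≥0, ∀ E (e : BPure E) s (y' : BPure E),
      t E y' (x.join e s) = c * if y' = e then (1 : ℝ) else 0) :
    t ∈ cone A [] := by
  choose C hC using h
  have : t = ∑ x, C x • effect x := by
    refine ext_join fun E y' a e s => ?_
    rw [hC]
    simp only [Finset.sum_apply, Matrix.sum_apply, Pi.smul_apply, Matrix.smul_apply,
      NNReal.smul_def, smul_eq_mul]
    rw [Finset.sum_eq_single a]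
    · rw [effect_join]; simp
    · intro b _ hb
      rw [effect_join]; simp [hb.symm]
    · simp
  rw [this]
  exact Submodule.sum_mem _ fun x _ =>
    Submodule.smul_mem _ _ (Submodule.subset_span (IsGenerator.effect x))

theorem state_mem {B : Sys} (y : BPure B) : state y ∈ cone [] B :=
  Submodule.subset_span (IsGenerator.state y)

theorem id_mem (A : Sys) : id A ∈ cone A A := by
  cases A with
  | nil =>
    refine mem_cone_effect _ fun x => ⟨1, fun E e s y' => ?_⟩
    change (1 : Matrix (BPure E) (BPure E) ℝ) y' e = _
    simp [Matrix.one_apply]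
  | cons n l =>
    refine mem_cone_atomic _ fun x => ⟨fun y τ => if y = x ∧ τ = 0 then 1 else 0,
      fun E e s y' => ?_⟩
    change (1 : Matrix (BPure ((n :: l) ++ E)) _ ℝ) y' (x.join e s) = _
    rw [Finset.sum_eq_single x, Finset.sum_eq_single 0] <;> simp +contextual [Matrix.one_apply]

/-- Composition with a fixed family on the left, as a linear map. -/
def compLeft {A B C : Sys} (u : Fam B C) : Fam A B →ₗ[ℝ≥0] Fam A C where
  toFun t := u.comp t
  map_add' t t' := by funext E; exact Matrix.mul_add (u E) (t E) (t' E)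
  map_smul' c t := by funext E; exact Matrix.mul_smul (u E) c (t E)

/-- Composition with a fixed family on the right, as a linear map. -/
def compRight {A B C : Sys} (t : Fam A B) : Fam B C →ₗ[ℝ≥0] Fam A C where
  toFun u := u.comp t
  map_add' u u' := by funext E; exact Matrix.add_mul (u E) (u' E) (t E)
  map_smul' c u := by funext E; exact Matrix.smul_mul c (u E) (t E)

/-- Parallel composition with an identity, as a linear map. -/
def parIdLin (A B C : Sys) : Fam A B →ₗ[ℝ≥0] Fam (A ++ C) (B ++ C) where
  toFun t := t.parId C
  map_add' _ _ := rfl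
  map_smul' _ _ := rfl

theorem comp_effect_join {A B E : Sys} (u : Fam [] B) (x a : BPure A) (e : BPure E) (s : Bit)
    (y : BPure (B ++ E)) :
    u.comp (effect x) E y (a.join e s) = if a = x then u E y e else 0 := by
  change ∑ z : BPure E, u E y z * effect x E z (a.join e s) = _
  simp only [effect_join]
  by_cases h : a = x <;> simp [h]

theorem comp_atomic_join {n m : Elem} {l k B E : Sys} (u : Fam (m :: k) B) (x a : BPure (n :: l))
    (y : BPure (m :: k)) (τ : Bit) (e : BPure E) (s : Bit) (y' : BPure (B ++ E)) :
    u.comp (atomic x y τ) E y' (a.join e s) =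
      if a = x then u E y' (y.join e (s + τ)) else 0 := by
  change ∑ z, u E y' z * atomic x y τ E z (a.join e s) = _
  simp only [atomic_join]
  by_cases h : a = x <;> simp [h]

theorem comp_state {B C E : Sys} (u : Fam B C) (y : BPure B) (e : BPure E) (y' : BPure (C ++ E)) :
    u.comp (state y) E y' e = (1 / 2) * ∑ s : Bit, u E y' (y.join e s) := by
  change ∑ z, u E y' z * ((1 / 2) * ∑ s : Bit, if z = y.join e s then (1 : ℝ) else 0) = _
  simp only [Fin.sum_univ_two, mul_add, Finset.sum_add_distrib]
  simp [mul_comm]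

theorem comp_mem {A B C : Sys} {u : Fam B C} {t : Fam A B} (hu : u ∈ cone B C)
    (ht : t ∈ cone A B) : u.comp t ∈ cone A C := by
  suffices h : ∀ t, IsGenerator A B t → ∀ u, IsGenerator B C u → u.comp t ∈ cone A C by
    have h1 : ∀ t, IsGenerator A B t → u.comp t ∈ cone A C := fun t ht =>
      (Submodule.span_le (p := (cone A C).comap (compRight t))).2 (fun u hu => h t ht u hu) hu
    exact (Submodule.span_le (p := (cone A C).comap (compLeft u))).2 (fun t ht => h1 t ht) ht
  intro t ht u hu
  cases ht with
  | state y =>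
    cases hu with
    | state z =>
      convert state_mem z using 1
      funext E
      ext y' e
      rw [comp_state]
      change (1 / 2) * ∑ s : Bit, state z E y' e = _
      simp
    | effect x =>
      refine mem_cone_effect _ fun x' => ⟨if y = x then 1 else 0, fun E e s y' => ?_⟩
      change (effect x).comp (state y) E y' e = _
      rw [comp_state]
      simp only [effect_join]
      by_cases h : y = x <;> simp [h]
    | atomic x z τ =>
      have : (atomic x z τ).comp (state y) =
          (if y = x then (1 : ℝ≥0) else 0) • state z := by
        funext E
        ext y' e
        rw [comp_state]
        simp only [atomic_join, Pi.smul_apply, Matrix.smul_apply, NNReal.smul_def, smul_eq_mul]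
        by_cases h : y = x
        · simp only [h, true_and, if_true, NNReal.coe_one, one_mul, state]
          congr 1
          exact Equiv.sum_comp (Equiv.addRight τ) (fun s => if y' = z.join e s then (1 : ℝ) else 0)
        · simp [h]
      rw [this]
      exact Submodule.smul_mem _ _ (state_mem z)
  | effect x =>
    cases hu with
    | effect z =>
      refine mem_cone_effect _ fun x' => ⟨if x' = x then 1 else 0, fun E e s y' => ?_⟩
      have h := effect_join z () e s y'
      rw [comp_effect_join]
      change (if x' = x then effect z E y' (BPure.join (A := []) () e s) else 0) = _
      rw [h]
      by_cases hx : x' = x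
      · simp [hx, show () = z from rfl]
      · simp [hx]
    | state z =>
      cases A with
      | nil =>
        convert state_mem z using 1
        refine ext_join fun E y' x' e s => ?_
        rw [comp_effect_join]
        exact if_pos (Subsingleton.elim (α := Unit) x' x)
      | cons n l =>
        cases C with
        | nil =>
          refine mem_cone_effect _ fun x' => ⟨if x' = x then 1 else 0, fun E e s y' => ?_⟩
          rw [comp_effect_join]
          change (if x' = x then (1 / 2) * ∑ s : Bit, (if y' = e then (1 : ℝ) else 0) else 0) = _
          by_cases hx : x' = x <;> simp [hx]
        | cons m k =>
          refine mem_cone_atomic _ fun x' => ⟨fun y _ => if x' = x ∧ y = z then 1 / 2 else 0,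
            fun E e s y' => ?_⟩
          rw [comp_effect_join, Finset.sum_eq_single z]
          · by_cases hx : x' = x
            · simp only [hx, true_and, if_true, state, NNReal.coe_div, NNReal.coe_one,
                NNReal.coe_ofNat, ← Finset.mul_sum]
              congr 1
              exact (Equiv.sum_comp (Equiv.addLeft s)
                (fun s => if y' = z.join e s then (1 : ℝ) else 0)).symm
            · simp [hx]
          · intro b _ hb
            simp [hb]
          · simp
  | atomic x y τ =>
    cases hu with
    | effect z =>
      refine mem_cone_effect _ fun x' => ⟨if x' = x ∧ y = z then 1 else 0, fun E e s y' => ?_⟩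
      rw [comp_atomic_join, effect_join]
      by_cases hx : x' = x <;> by_cases hy : y = z <;> simp [hx, hy]
    | atomic z w σ =>
      refine mem_cone_atomic _ fun x' =>
        ⟨fun w' ρ => if x' = x ∧ y = z ∧ w' = w ∧ ρ = τ + σ then 1 else 0, fun E e s y' => ?_⟩
      rw [comp_atomic_join, atomic_join, Finset.sum_eq_single w, Finset.sum_eq_single (τ + σ)]
      · by_cases hx : x' = x <;> by_cases hy : y = z <;> simp [hx, hy, add_assoc]
      · intro b _ hb
        simp [hb]
      · simp
      · intro b _ hb
        simp [hb]
      · simp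

theorem parId_mem {A B : Sys} {t : Fam A B} (ht : t ∈ cone A B) (C : Sys) :
    t.parId C ∈ cone (A ++ C) (B ++ C) := by
  suffices h : ∀ t, IsGenerator A B t → t.parId C ∈ cone (A ++ C) (B ++ C) from
    (Submodule.span_le (p := (cone (A ++ C) (B ++ C)).comap (parIdLin A B C))).2
      (fun t ht => h t ht) ht
  intro t ht
  cases ht with
  | state y =>
    cases B with
    | nil =>
      suffices h : (state y).parId C = (id C : Fam ([] ++ C) ([] ++ C)) by
        rw [h]
        exact id_mem C
      funext E
      ext y' x'
      change (1 / 2) * ∑ s : Bit, (if y' = x' then (1 : ℝ) else 0) =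
        (1 : Matrix (BPure (C ++ E)) (BPure (C ++ E)) ℝ) y' x'
      simp [Matrix.one_apply]
    | cons m k =>
      cases C with
      | nil =>
        suffices h : (state y).parId [] =
            (state (y.join (E := []) () 0) : Fam ([] ++ []) ((m :: k) ++ [])) by
          rw [h]
          exact state_mem (y.join (E := []) () 0)
        funext E
        refine Matrix.ext fun y' (e : BPure E) => ?_
        change (1 / 2) * ∑ s : Bit, (if BPure.assoc (m :: k) [] E y' = y.join (E := [] ++ E) e s
          then (1 : ℝ) else 0) = (1 / 2) * ∑ s : Bit, if y' = _ then (1 : ℝ) else 0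
        congr 1
        refine Finset.sum_congr rfl fun s _ => ?_
        rw [← BPure.assoc_join_nil y e 0 s]
        exact ite_equiv (BPure.assoc (m :: k) [] E) _ _
      | cons c C =>
        refine mem_cone_atomic _ fun z =>
          ⟨fun w ρ => if w = y.join z ρ then 1 / 2 else 0, fun E e s y' => ?_⟩
        change (1 / 2) * ∑ ρ : Bit, (if BPure.assoc (m :: k) (c :: C) E y' =
          y.join (z.join e s) ρ then (1 : ℝ) else 0) = _
        rw [Finset.sum_comm, Finset.mul_sum]
        refine Finset.sum_congr rfl fun ρ _ => ?_
        refine Eq.symm ((Finset.sum_eq_single (y.join z ρ) ?_ ?_).trans ?_)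
        · intro b _ hb
          simp [hb]
        · intro hb
          exact absurd (Finset.mem_univ _) hb
        · have h := BPure.assoc_join y z e ρ (s + ρ)
          rw [show ρ + (s + ρ) = s by rw [add_left_comm, bit_add_self, add_zero]] at h
          rw [← h, ite_equiv (BPure.assoc (m :: k) (c :: C) E)]
          simp
  | effect x =>
    cases A with
    | nil =>
      suffices h : (effect x).parId C = (id C : Fam ([] ++ C) ([] ++ C)) by
        rw [h]
        exact id_mem C
      funext E
      ext y' x'
      have h := effect_join (E := C ++ E) x () x' 0 y'
      change effect x (C ++ E) y' (BPure.join (A := []) () x' 0) =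
        (1 : Matrix (BPure (C ++ E)) (BPure (C ++ E)) ℝ) y' x'
      rw [h, Matrix.one_apply]
      simp [show () = x from rfl]
    | cons n l =>
      cases C with
      | nil =>
        refine mem_cone_effect _ fun X => ?_
        obtain ⟨a, ⟨⟩, r, rfl⟩ := BPure.join_surj (A := n :: l) (E := []) X
        refine ⟨if a = x then 1 else 0, fun E e s y' => ?_⟩
        have h := effect_join (E := [] ++ E) x a e s y'
        rw [← BPure.assoc_join_nil a e r s] at h
        refine h.trans ?_
        by_cases ha : a = x <;> simp [ha]
      | cons c C =>
        refine mem_cone_atomic' _ fun X => ?_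
        obtain ⟨a, z, r, rfl⟩ := BPure.join_surj (A := n :: l) (E := c :: C) X
        refine ⟨if a = x then 1 else 0, z, r, fun E e s y' => ?_⟩
        change effect x ((c :: C) ++ E) y' (BPure.assoc (n :: l) (c :: C) E
          ((a.join z r).join e s)) = _
        rw [BPure.assoc_join, effect_join, add_comm r s]
        by_cases ha : a = x <;> simp [ha]
  | @atomic n m l k x y τ =>
    refine mem_cone_atomic' (n := n) (m := m) (l := l ++ C) (k := k ++ C) _ fun X => ?_
    cases C with
    | nil =>
      obtain ⟨a, ⟨⟩, r, rfl⟩ := BPure.join_surj (A := n :: l) (E := []) X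
      refine ⟨if a = x then 1 else 0, y.join (E := []) () 0, τ, fun E e s y' => ?_⟩
      change atomic x y τ ([] ++ E) (BPure.assoc (m :: k) [] E y') (BPure.assoc (n :: l) [] E
        ((a.join (E := []) () r).join e s)) = _
      rw [BPure.assoc_join_nil, atomic_join, ← BPure.assoc_join_nil y e 0 (s + τ)]
      by_cases ha : a = x <;> simp [ha]
    | cons c C =>
      obtain ⟨a, z, r, rfl⟩ := BPure.join_surj (A := n :: l) (E := c :: C) X
      refine ⟨if a = x then 1 else 0, y.join z (r + τ), τ, fun E e s y' => ?_⟩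
      change atomic x y τ ((c :: C) ++ E) (BPure.assoc (m :: k) (c :: C) E y')
        (BPure.assoc (n :: l) (c :: C) E ((a.join z r).join e s)) = _
      have h := BPure.assoc_join y z e (r + τ) (s + τ)
      rw [show r + τ + (s + τ) = r + s by
        rw [add_add_add_comm, bit_add_self, add_zero]] at h
      rw [BPure.assoc_join, atomic_join, ← h]
      by_cases ha : a = x <;> simp [ha]

theorem swap_join {A B E : Sys} (a : BPure A) (b : BPure B) (s : Bit)
    (hs : A = [] ∨ B = [] → s = 0) (e : BPure E) (t : Bit) (y' : BPure ((B ++ A) ++ E)) :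
    swap A B E y' ((a.join b s).join e t) =
      if y' = (b.join a s).join e (t + s) then 1 else 0 := by
  unfold swap
  congr 1
  refine propext ⟨?_, ?_⟩
  · rintro ⟨a', b', e', s', t', hs', h, rfl⟩
    obtain ⟨h1, rfl, h2⟩ := BPure.join_inj h
    obtain ⟨rfl, rfl, h3⟩ := BPure.join_inj h1
    have h4 : s = s' := by
      rcases h3 with h3 | h3 | h3
      · rw [hs (Or.inl h3), hs' (Or.inl h3)]
      · rw [hs (Or.inr h3), hs' (Or.inr h3)]
      · exact h3
    subst h4
    rcases h2 with h2 | h2 | h2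
    · refine BPure.join_triv (Or.inl ?_) _ _ _ _
      rw [List.append_eq_nil_iff] at h2 ⊢
      exact h2.symm
    · exact BPure.join_triv (Or.inr h2) _ _ _ _
    · rw [h2, add_comm]
  · rintro rfl
    exact ⟨a, b, e, s, t, hs, rfl, by rw [add_comm]⟩

theorem join_surj_zero {A B : Sys} (x : BPure (A ++ B)) : ∃ (a : BPure A) (b : BPure B) (s : Bit),
    (A = [] ∨ B = [] → s = 0) ∧ x = a.join b s := by
  obtain ⟨a, b, s, rfl⟩ := BPure.join_surj x
  by_cases h : A = [] ∨ B = []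
  · exact ⟨a, b, 0, fun _ => rfl, BPure.join_triv h _ _ _ _⟩
  · exact ⟨a, b, s, fun h' => absurd h' h, rfl⟩

theorem swap_mem (A B : Sys) : swap A B ∈ cone (A ++ B) (B ++ A) := by
  have key : ∀ X : BPure (A ++ B), ∃ (c : ℝ≥0) (y : BPure (B ++ A)) (τ : Bit),
      ∀ E (e : BPure E) s y',
        swap A B E y' (X.join e s) = c * if y' = y.join e (s + τ) then (1 : ℝ) else 0 := by
    intro X
    obtain ⟨a, b, r, hr, rfl⟩ := join_surj_zero X
    refine ⟨1, b.join a r, r, fun E e s y' => ?_⟩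
    rw [swap_join a b r hr]
    simp
  cases A with
  | nil =>
    cases B with
    | nil =>
      refine mem_cone_effect _ fun X => ?_
      obtain ⟨c, y, τ, h⟩ := key X
      exact ⟨c, h⟩
    | cons m k =>
      refine mem_cone_atomic' (n := m) (m := m) (l := k) (k := k ++ []) _ ?_
      exact key
  | cons n l =>
    cases B with
    | nil =>
      refine mem_cone_atomic' (n := n) (m := n) (l := l ++ []) (k := l) _ ?_
      exact key
    | cons m k =>
      exact mem_cone_atomic' (n := n) (m := m) (l := l ++ m :: k) (k := k ++ n :: l) _ key

theorem par_mem {A B C D : Sys} {t : Fam A B} {u : Fam C D} (ht : t ∈ cone A B)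
    (hu : u ∈ cone C D) : t.par u ∈ cone (A ++ C) (B ++ D) :=
  comp_mem (comp_mem (swap_mem D B) (comp_mem (parId_mem hu B) (swap_mem B C))) (parId_mem ht C)

theorem discard_mem (A : Sys) : discard A ∈ cone A [] :=
  Submodule.sum_mem _ fun x _ => Submodule.subset_span (IsGenerator.effect x)

theorem nonneg_of_mem {A B : Sys} {t : Fam A B} (ht : t ∈ cone A B) (E : Sys)
    (y : BPure (B ++ E)) (x : BPure (A ++ E)) : 0 ≤ t E y x := by
  induction ht using Submodule.span_induction with
  | mem t ht =>
    cases ht with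
    | state z =>
      exact mul_nonneg (by norm_num) (Finset.sum_nonneg fun s _ => by split_ifs <;> norm_num)
    | effect z => unfold effect; split_ifs <;> norm_num
    | atomic z w τ => unfold atomic; split_ifs <;> norm_num
  | zero => exact le_rfl
  | add t u _ _ ht hu => exact add_nonneg ht hu
  | smul c t _ ht => exact mul_nonneg c.2 ht

/-- `t_E` maps states to states (subnormalised distributions over pure states), for every `E`. -/
def IsSubnormalised {A B : Sys} (t : Fam A B) : Prop :=
  ∀ (E : Sys) (x : BPure (A ++ E)), ∑ y, t E y x ≤ 1

theorem comp_sub {A B C : Sys} {u : Fam B C} {t : Fam A B} (hu : u.IsSubnormalised)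
    (ht : t.IsSubnormalised) (h : t ∈ cone A B) : (u.comp t).IsSubnormalised := by
  intro E x
  change ∑ y, ∑ z, u E y z * t E z x ≤ 1
  rw [Finset.sum_comm]
  refine le_trans (Finset.sum_le_sum fun z _ => ?_) (ht E x)
  rw [← Finset.sum_mul]
  exact mul_le_of_le_one_left (nonneg_of_mem h E z x) (hu E z)

theorem parId_sub {A B : Sys} {t : Fam A B} (ht : t.IsSubnormalised) (C : Sys) :
    (t.parId C).IsSubnormalised := by
  intro E x
  change ∑ y, t (C ++ E) (BPure.assoc B C E y) (BPure.assoc A C E x) ≤ 1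
  rw [(BPure.assoc B C E).sum_comp (fun y => t (C ++ E) y (BPure.assoc A C E x))]
  exact ht _ _

theorem swap_sub (A B : Sys) : (swap A B).IsSubnormalised := by
  intro E x
  obtain ⟨X, e, t, rfl⟩ := BPure.join_surj x
  obtain ⟨a, b, s, hs, rfl⟩ := join_surj_zero X
  simp [swap_join a b s hs]

theorem id_sub (A : Sys) : (id A).IsSubnormalised := by
  intro E x
  change ∑ y, (1 : Matrix (BPure (A ++ E)) (BPure (A ++ E)) ℝ) y x ≤ 1
  simp [Matrix.one_apply]

theorem par_sub {A B C D : Sys} {t : Fam A B} {u : Fam C D} (ht : t.IsSubnormalised)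
    (hu : u.IsSubnormalised) (ht' : t ∈ cone A B) (hu' : u ∈ cone C D) :
    (t.par u).IsSubnormalised :=
  comp_sub (comp_sub (swap_sub D B) (comp_sub (parId_sub hu B) (swap_sub B C) (swap_mem B C))
    (comp_mem (parId_mem hu' B) (swap_mem B C))) (parId_sub ht C) (parId_mem ht' C)

theorem discard_join {A E : Sys} (a : BPure A) (e : BPure E) (s : Bit) (y : BPure E) :
    discard A E y (a.join e s) = if y = e then 1 else 0 := by
  unfold discard
  rw [Finset.sum_apply, Matrix.sum_apply, Finset.sum_eq_single a]
  · rw [effect_join]; simp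
  · intro b _ hb
    rw [effect_join]; simp [hb.symm]
  · simp

theorem discard_sub (A : Sys) : (discard A).IsSubnormalised := by
  intro E x
  obtain ⟨a, e, t, rfl⟩ := BPure.join_surj x
  change ∑ y : BPure E, discard A E y (a.join e t) ≤ 1
  simp [discard_join]

theorem state_sub {B : Sys} (y : BPure B) : (state y).IsSubnormalised := by
  intro E x
  change ∑ y', (1 / 2) * ∑ s : Bit, (if y' = y.join x s then (1 : ℝ) else 0) ≤ 1
  rw [← Finset.mul_sum, Finset.sum_comm]
  simp

theorem effect_sub {A : Sys} (x : BPure A) : (effect x).IsSubnormalised := by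
  intro E x'
  obtain ⟨a, e, t, rfl⟩ := BPure.join_surj x'
  change ∑ y : BPure E, effect x E y (a.join e t) ≤ 1
  simp only [effect_join]
  by_cases h : a = x <;> simp [h]

theorem atomic_sub {n m : Elem} {l k : Sys} (x : BPure (n :: l)) (y : BPure (m :: k)) (τ : Bit) :
    (atomic x y τ).IsSubnormalised := by
  intro E x'
  obtain ⟨a, e, t, rfl⟩ := BPure.join_surj x'
  simp only [atomic_join]
  by_cases h : a = x <;> simp [h]

end Fam

/-- Transformations of bilocal classical theory from `A` to `B`: the conical combinations of
normalised atomic transformations (of pure states if `A` is trivial, of pure effects if `B` is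
trivial) that map states to states. -/
@[ext] structure BTransf (A B : Sys) where
  fam : Fam A B
  mem_cone : fam ∈ Fam.cone A B
  sub : fam.IsSubnormalised

namespace BTransf

/-- A pure state. -/
def state {B : Sys} (y : BPure B) : BTransf [] B :=
  ⟨Fam.state y, Submodule.subset_span (.state y), Fam.state_sub y⟩

/-- A pure effect. -/
def effect {A : Sys} (x : BPure A) : BTransf A [] :=
  ⟨Fam.effect x, Submodule.subset_span (.effect x), Fam.effect_sub x⟩

/-- A normalised atomic transformation. -/
def atomic {n m : Elem} {l k : Sys} (x : BPure (n :: l)) (y : BPure (m :: k)) (τ : Bit) :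
    BTransf (n :: l) (m :: k) :=
  ⟨Fam.atomic x y τ, Submodule.subset_span (.atomic x y τ), Fam.atomic_sub x y τ⟩

/-- Sequential composition: first `t`, then `u`. -/
def comp {A B C : Sys} (u : BTransf B C) (t : BTransf A B) : BTransf A C :=
  ⟨u.fam.comp t.fam, Fam.comp_mem u.mem_cone t.mem_cone, Fam.comp_sub u.sub t.sub t.mem_cone⟩

/-- Parallel composition. -/
def par {A B C D : Sys} (t : BTransf A B) (u : BTransf C D) : BTransf (A ++ C) (B ++ D) :=
  ⟨t.fam.par u.fam, Fam.par_mem t.mem_cone u.mem_cone,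
    Fam.par_sub t.sub u.sub t.mem_cone u.mem_cone⟩

/-- The identity. -/
def id (A : Sys) : BTransf A A := ⟨Fam.id A, Fam.id_mem A, Fam.id_sub A⟩

/-- The swap. -/
def swap (A B : Sys) : BTransf (A ++ B) (B ++ A) :=
  ⟨Fam.swap A B, Fam.swap_mem A B, Fam.swap_sub A B⟩

/-- The deterministic effect. -/
def discard (A : Sys) : BTransf A [] := ⟨Fam.discard A, Fam.discard_mem A, Fam.discard_sub A⟩

/-- A transformation is deterministic if it preserves the deterministic effect. -/
def IsDeterministic {A B : Sys} (t : BTransf A B) : Prop := (discard B).comp t = discard A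

/-- A finite family of transformations is an instrument if its full coarse-graining preserves the
deterministic effect. -/
def IsInstrument {A B : Sys} {X : Type} [Fintype X] (t : X → BTransf A B) : Prop :=
  (Fam.discard B).comp (∑ k, (t k).fam) = Fam.discard A

/-- The number by which a scalar multiplies. -/
def prob (p : BTransf [] []) : ℝ := p.fam [] () ()

end BTransf

/-- The single entry of a classical scalar. -/
def CTransf.prob (p : CTransf [] []) : ℝ := p.mat () ()

/-! ### Ontological models -/

/-- Maps from bilocal classical theory to classical theory, on systems and transformations. -/
structure TheoryMap where
  obj : Sys → Sys
  obj_nil : obj [] = []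
  map : (A B : Sys) → BTransf A B → CTransf (obj A) (obj B)

namespace TheoryMap

/-- `ξ(∑ r_x t_x) = ∑ r_x ξ(t_x)` for real `r_x`, whenever `∑ r_x t_x` is a transformation. -/
def IsLinear (ξ : TheoryMap) : Prop :=
  ∀ (A B : Sys) (X : Type) [Fintype X] (r : X → ℝ) (t : X → BTransf A B) (s : BTransf A B),
    s.fam = ∑ x, r x • (t x).fam → (ξ.map A B s).mat = ∑ x, r x • (ξ.map A B (t x)).mat

/-- Preservation of composite systems, of sequential and parallel composition, of identities and
of swaps. -/
structure IsDiagramPreserving (ξ : TheoryMap) : Prop where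
  obj_append : ∀ A B : Sys, ξ.obj (A ++ B) = ξ.obj A ++ ξ.obj B
  map_comp : ∀ (A B C : Sys) (u : BTransf B C) (t : BTransf A B),
    ξ.map A C (u.comp t) = (ξ.map B C u).comp (ξ.map A B t)
  map_par : ∀ (A B C D : Sys) (t : BTransf A B) (u : BTransf C D),
    (ξ.map (A ++ C) (B ++ D) (t.par u)).cast (obj_append A C) (obj_append B D) =
      (ξ.map A B t).par (ξ.map C D u)
  map_id : ∀ A : Sys, ξ.map A A (BTransf.id A) = CTransf.id (ξ.obj A)
  map_swap : ∀ A B : Sys,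
    (ξ.map (A ++ B) (B ++ A) (BTransf.swap A B)).cast (obj_append A B) (obj_append B A) =
      CTransf.swap (ξ.obj A) (ξ.obj B)

/-- Every scalar `p` is mapped to `p`. -/
def IsProbabilityPreserving (ξ : TheoryMap) : Prop :=
  ∀ p : BTransf [] [], ((ξ.map [] [] p).cast ξ.obj_nil ξ.obj_nil).prob = p.prob

/-- Instruments are mapped to instruments. -/
def PreservesInstruments (ξ : TheoryMap) : Prop :=
  ∀ (A B : Sys) (X : Type) [Fintype X] (t : X → BTransf A B),
    BTransf.IsInstrument t → CTransf.IsInstrument fun x => ξ.map A B (t x)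

/-- Deterministic effects are mapped to deterministic effects. -/
def PreservesDeterministicEffects (ξ : TheoryMap) : Prop :=
  ∀ (A : Sys) (e : BTransf A []), e.IsDeterministic →
    (ξ.map A [] e).cast rfl ξ.obj_nil = CTransf.discard (ξ.obj A)

/-- Ontological models of bilocal classical theory. -/
structure IsOntologicalModel (ξ : TheoryMap) : Prop where
  linear : ξ.IsLinear
  diagram : ξ.IsDiagramPreserving
  probability : ξ.IsProbabilityPreserving
  instruments : ξ.PreservesInstruments

end TheoryMap

/-! ### The model -/

/-- The dimension `2n`. -/
def double (n : Elem) : Elem := ⟨n.1 * 2, le_trans n.2 (Nat.le_mul_of_pos_right _ two_pos)⟩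

/-- The classical system assigned to `n₁ ⊠ ⋯ ⊠ n_p`: the composite of systems of dimension
`2n₁, …, 2n_p`. -/
def ontic (A : Sys) : Sys := A.map double

/-- A classical system of dimension `2n` is `n` tensored with a bit. -/
def enc (n : Elem) : Fin n.1 × Bit ≃ Fin (double n).1 := finProdFinEquiv

/-- Each subsystem after the first one receives a copy of the bit `b`, to which the NOT gate
controlled by the bit of that subsystem is applied. -/
def Tail.lift : {l : Sys} → Tail l → Bit → CPure (ontic l)
  | [], _, _ => ()
  | n :: _, ((j, s), u), b => (enc n (j, b + s), Tail.lift u b)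

/-- The classical pure state
`|i₁, b) |i₂, b ⊕ s₁) ⋯ |i_p, b ⊕ s_{p-1})` for `((i₁ i₂)_{s₁} ⋯ i_p)_{s_{p-1}}` and a bit `b`. -/
def BPure.lift : {A : Sys} → BPure A → Bit → CPure (ontic A)
  | [], _, _ => ()
  | n :: _, (i, u), b => (enc n (i, b), Tail.lift u b)

/-- The map of theories with the assignment `ontic` on systems. -/
def TheoryMap.ofFamily (f : (A B : Sys) → BTransf A B → CTransf (ontic A) (ontic B)) :
    TheoryMap where
  obj := ontic
  obj_nil := rfl
  map := f

open Classical in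
/-- The values that specify the model: on pure states a uniformly random bit `b` is copied to all
subsystems; on pure effects the bit is discarded; the normalised atomic transformation
`𝒜_x^{y,τ}` maps the bit `b` to `b ⊕ τ`. -/
structure IsStandardModel (f : (A B : Sys) → BTransf A B → CTransf (ontic A) (ontic B)) :
    Prop where
  state : ∀ (B : Sys) (y : BPure B) (y' : CPure (ontic B)) (z : CPure (ontic [])),
    (f [] B (BTransf.state y)).mat y' z = (1 / 2) * ∑ b : Bit, if y' = y.lift b then 1 else 0
  effect : ∀ (A : Sys) (x : BPure A) (x' : CPure (ontic A)) (z : CPure (ontic [])),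
    (f A [] (BTransf.effect x)).mat z x' = if ∃ b : Bit, x' = x.lift b then 1 else 0
  atomic : ∀ (n m : Elem) (l k : Sys) (x : BPure (n :: l)) (y : BPure (m :: k)) (τ : Bit)
    (y' : CPure (ontic (m :: k))) (x' : CPure (ontic (n :: l))),
    (f (n :: l) (m :: k) (BTransf.atomic x y τ)).mat y' x' =
      if ∃ b : Bit, x' = x.lift b ∧ y' = y.lift (b + τ) then 1 else 0
  one : f [] [] (BTransf.id []) = CTransf.id []

end BilocalClassical

end

open scoped NNReal Kronecker

noncomputable section

namespace BilocalClassical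

/-! ### Ontic states as pure states with a bit -/

/-! An ontic state `|x;b)` carries the same data as a pure state `(x e)_b` of `A` with an ancilla,
where `e` is a fixed pure state of a fixed elementary system: in both, the bit is lost exactly when
`A` is trivial (`join_ancilla_iff`). This turns the ontic representation into part of the theory
itself: the matrix of `t` is `t` at that ancilla, restricted to the pure states whose ancilla part
is `e`.

A transformation preserves the ancilla state and changes at most the bit (`Fam.eq_zero_of_mem`), so
the restriction loses no probability and no intermediate state (`Fam.probe_sum`). Linearity,
identities, sequential composition, substochasticity and the preservation of instruments are then
inherited from the families.

The substantial point is parallel composition, which involves `t` at the ancilla `C ⊠ e`. Rewriting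
`((a c)_s e)_b` as `(a (c e)_{s⊕b})_s`, a generator that flips the bit flips `s` and `b` together,
hence fixes `s ⊕ b`, the bit seen by `c`. So `t ⊠ I_C` acts as `t` on `|a;b)` and fixes `|c;b⊕s)`
(`Fam.probe_assoc`), which is the Kronecker product with the identity. The BCT swap becomes the
classical swap (`model_swap_mat`), and general parallel composition follows from its definition
through swaps.

Uniqueness holds because every transformation is a conical combination of generators that are
themselves transformations, and the prescribed values fix a linear map on these. -/

theorem Tail.lift_shift : ∀ {l : Sys} (s : Bit) (u : Tail l) (b : Bit),
    Tail.lift (Tail.shift s u) b = Tail.lift u (b + s)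
  | [], _, _, _ => rfl
  | n :: _, s, ((j, r), u), b => by
      change (enc n (j, b + (s + r)), Tail.lift (Tail.shift s u) b) =
        (enc n (j, b + s + r), Tail.lift u (b + s))
      rw [Tail.lift_shift, add_assoc]

theorem Tail.lift_surj : ∀ {l : Sys} (w : CPure (ontic l)) (b : Bit), ∃ u : Tail l, w = u.lift b
  | [], _, _ => ⟨(), rfl⟩
  | n :: l, (p, w), b => by
      obtain ⟨u, rfl⟩ := Tail.lift_surj (l := l) w b
      obtain ⟨⟨j, r⟩, rfl⟩ := (enc n).surjective p
      -- The tail stores bits relative to `b`, so the absolute bit `r` is stored as `b + r`; lifting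
      -- adds `b` again and the two cancel.
      refine ⟨((j, b + r), u), ?_⟩
      change _ = (enc n (j, b + (b + r)), Tail.lift u b)
      rw [← add_assoc, bit_add_self, zero_add]
      rfl

theorem Tail.lift_inj : ∀ {l : Sys} {u u' : Tail l} {b : Bit}, u.lift b = u'.lift b → u = u'
  | [], _, _, _, _ => rfl
  | n :: _, ((j, r), u), ((j', r'), u'), b, h => by
      have h1 : enc n (j, b + r) = enc n (j', b + r') := congrArg Prod.fst h
      have h2 := Tail.lift_inj (u := u) (u' := u') (congrArg Prod.snd h)
      obtain ⟨rfl, h3⟩ := Prod.ext_iff.1 ((enc n).injective h1)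
      rw [h2, add_left_cancel (show b + r = b + r' from h3)]

/-- The bit is read off the first subsystem, and the remaining bits are then taken relative to it.
-/
theorem BPure.lift_surj : ∀ {A : Sys} (w : CPure (ontic A)),
    ∃ (x : BPure A) (b : Bit), w = x.lift b
  | [], _ => ⟨(), 0, rfl⟩
  | n :: l, (p, w) => by
      obtain ⟨⟨i, b⟩, rfl⟩ := (enc n).surjective p
      obtain ⟨u, rfl⟩ := Tail.lift_surj (l := l) w b
      exact ⟨(i, u), b, rfl⟩

theorem BPure.lift_inj : ∀ {A : Sys} {x x' : BPure A} {b b' : Bit},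
    x.lift b = x'.lift b' → x = x' ∧ (A = [] ∨ b = b')
  | [], _, _, _, _, _ => ⟨rfl, Or.inl rfl⟩
  | n :: _, (i, u), (i', u'), b, b', h => by
      have h1 : enc n (i, b) = enc n (i', b') := congrArg Prod.fst h
      obtain ⟨rfl, rfl⟩ := Prod.ext_iff.1 ((enc n).injective h1)
      have h2 := Tail.lift_inj (u := u) (u' := u') (congrArg Prod.snd h)
      exact ⟨by rw [h2], Or.inr rfl⟩

theorem BPure.lift_triv {A : Sys} (h : A = []) (x : BPure A) (b b' : Bit) :
    x.lift b = x.lift b' := by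
  subst h
  rfl

theorem BPure.lift_eq_lift_iff {A : Sys} {x x' : BPure A} {b b' : Bit} :
    x.lift b = x'.lift b' ↔ x = x' ∧ (A = [] ∨ b = b') := by
  refine ⟨BPure.lift_inj, ?_⟩
  rintro ⟨rfl, h | rfl⟩
  · exact BPure.lift_triv h _ _ _
  · rfl

theorem BPure.join_eq_join_iff {A E : Sys} {a a' : BPure A} {e e' : BPure E} {s s' : Bit} :
    a.join e s = a'.join e' s' ↔ a = a' ∧ e = e' ∧ (A = [] ∨ E = [] ∨ s = s') := by
  refine ⟨BPure.join_inj, ?_⟩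
  rintro ⟨rfl, rfl, h | h | rfl⟩
  · exact BPure.join_triv (Or.inl h) _ _ _ _
  · exact BPure.join_triv (Or.inr h) _ _ _ _
  · rfl

/-- Attaching with `s` changes the reference bit of `e` from `b` to `b + s`; this is where the bit
of a composite state enters the ontic picture. -/
theorem BPure.lift_attach : ∀ {E : Sys} (e : BPure E) (s b : Bit),
    Tail.lift (e.attach s) b = e.lift (b + s)
  | [], _, _, _ => rfl
  | n :: _, (j, v), s, b => by
      change (enc n (j, b + s), Tail.lift (Tail.shift s v) b) =
        (enc n (j, b + s), Tail.lift v (b + s))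
      rw [Tail.lift_shift]

/-! ### Composite ontic systems -/

theorem ontic_append (A C : Sys) : ontic (A ++ C) = ontic A ++ ontic C := List.map_append

/-- An ontic state of `AC` is an ontic state of `A` together with one of `C`. -/
def onticSplit (A C : Sys) : CPure (ontic (A ++ C)) ≃ CPure (ontic A) × CPure (ontic C) :=
  (Equiv.cast (congrArg CPure (ontic_append A C))).trans (CPure.split (ontic A) (ontic C))

/-- Transport along an equality of tails leaves the head alone, so the cast inside `onticSplit` can
be moved through the recursion on systems. -/
theorem CPure.cast_cons {m : Elem} {X Y : Sys} (h : X = Y) (p : Fin m.1) (w : CPure X) :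
    _root_.cast (congrArg (fun Z => CPure (m :: Z)) h) (show CPure (m :: X) from (p, w)) =
      (show CPure (m :: Y) from (p, _root_.cast (congrArg CPure h) w)) := by
  subst h
  rfl

theorem onticSplit_cons (n : Elem) (l C : Sys) (p : Fin (double n).1)
    (w : CPure (ontic (l ++ C))) :
    onticSplit (n :: l) C (p, w) = ((p, (onticSplit l C w).1), (onticSplit l C w).2) := by
  have h := CPure.cast_cons (m := double n) (ontic_append l C) p w
  change CPure.split (double n :: ontic l) (ontic C) (_root_.cast _ (p, w)) = _
  exact (congrArg (CPure.split (double n :: ontic l) (ontic C)) h).trans rfl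

theorem onticSplit_append : ∀ {l C : Sys} (u : Tail l) (v : Tail C) (b : Bit),
    onticSplit l C (Tail.lift (Tail.append u v) b) = (u.lift b, v.lift b)
  | [], _, _, _, _ => rfl
  | n :: l, C, ((j, r), u), v, b => by
      refine (onticSplit_cons n l C (enc n (j, b + r)) (Tail.lift (Tail.append u v) b)).trans ?_
      rw [onticSplit_append]
      rfl

/-- The hypothesis excludes the one case where the two sides disagree: for trivial `A` the join
ignores `s`, whereas the lift of `c` on the right sees it unless `C` is trivial too. -/
theorem onticSplit_join {A C : Sys} (a : BPure A) (c : BPure C) (s b : Bit)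
    (h : A = [] → C = [] ∨ s = 0) :
    onticSplit A C ((a.join c s).lift b) = (a.lift b, c.lift (b + s)) := by
  cases A with
  | nil =>
    change ((), c.lift b) = ((), c.lift (b + s))
    rcases h rfl with h | rfl
    · rw [BPure.lift_triv h]
    · rw [add_zero]
  | cons n l =>
    obtain ⟨i, u⟩ := a
    refine (onticSplit_cons n l C (enc n (i, b)) (Tail.lift (Tail.append u (c.attach s)) b)).trans
      ?_
    rw [onticSplit_append, BPure.lift_attach]
    rfl

theorem CTransf.cast_mat {A A' B B' : Sys} (hA : A = A') (hB : B = B') (t : CTransf A B)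
    (y : CPure B') (x : CPure A') :
    (t.cast hA hB).mat y x =
      t.mat ((Equiv.cast (congrArg CPure hB)).symm y) ((Equiv.cast (congrArg CPure hA)).symm x) := by
  subst hA hB
  rfl

/-- Removes the transports from the statements about composites, so that swaps and parallel
composition can be treated entrywise through `onticSplit`. -/
theorem CTransf.cast_onticSplit {A B C D : Sys}
    (t : CTransf (ontic (A ++ C)) (ontic (B ++ D))) (y : CPure (ontic B ++ ontic D))
    (x : CPure (ontic A ++ ontic C)) :
    (t.cast (ontic_append A C) (ontic_append B D)).mat y x =
      t.mat ((onticSplit B D).symm (CPure.split _ _ y))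
        ((onticSplit A C).symm (CPure.split _ _ x)) := by
  simp [CTransf.cast_mat, onticSplit]

/-! ### Probing with a fixed ancilla -/

/-- An ancilla of dimension two. -/
def ancilla : Sys := [⟨2, le_rfl⟩]

/-- A pure state of the ancilla. -/
def ancillaState : BPure ancilla := ((0 : Fin 2), ())

theorem ancilla_ne_nil : ancilla ≠ [] := List.cons_ne_nil _ _

/-- Because the ancilla is non-trivial, the bit is redundant on either side only for trivial `A`.
This is the dictionary between ontic states and probing states. -/
theorem join_ancilla_iff {A : Sys} {x x' : BPure A} {b b' : Bit} :
    x.join ancillaState b = x'.join ancillaState b' ↔ x.lift b = x'.lift b' := by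
  rw [BPure.join_eq_join_iff, BPure.lift_eq_lift_iff]
  simp [ancilla_ne_nil]

/-- The ontic state `|x;b)` probes a transformation at `(x e)_b`, with `e` a fixed state of the
ancilla. -/
def probe {A : Sys} (w : CPure (ontic A)) : BPure (A ++ ancilla) :=
  (BPure.lift_surj w).choose.join ancillaState (BPure.lift_surj w).choose_spec.choose

/-- The chosen representative can differ from `(x, b)` only in a redundant bit, which the join
ignores as well. -/
theorem probe_lift {A : Sys} (x : BPure A) (b : Bit) :
    probe (x.lift b) = x.join ancillaState b :=
  join_ancilla_iff.2 (BPure.lift_surj (x.lift b)).choose_spec.choose_spec.symm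

theorem probe_injective {A : Sys} : Function.Injective (probe (A := A)) := by
  intro w w' h
  obtain ⟨x, b, rfl⟩ := BPure.lift_surj w
  obtain ⟨x', b', rfl⟩ := BPure.lift_surj w'
  rw [probe_lift, probe_lift] at h
  exact join_ancilla_iff.1 h

/-- A transformation acts on the ancilla by changing at most the bit. -/
theorem Fam.eq_zero_of_mem {A B : Sys} {t : Fam A B} (ht : t ∈ cone A B) {E : Sys}
    (x : BPure A) (e : BPure E) (s : Bit) (y' : BPure (B ++ E))
    (hy : ∀ (y : BPure B) (s' : Bit), y' ≠ y.join e s') : t E y' (x.join e s) = 0 := by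
  induction ht using Submodule.span_induction with
  | mem t ht =>
    cases ht with
    | state z =>
      change (1 / 2) * ∑ r : Bit, (if y' = z.join e r then (1 : ℝ) else 0) = 0
      simp [hy z]
    | effect z =>
      rw [effect_join]
      exact if_neg fun h => hy () 0 h.2
    | atomic z w τ =>
      rw [atomic_join]
      exact if_neg fun h => hy _ _ h.2
  | zero => rfl
  | add t u _ _ ht hu =>
    change t E y' _ + u E y' _ = 0
    rw [ht, hu, add_zero]
  | smul c t _ ht =>
    change c • t E y' _ = 0
    rw [ht, smul_zero]

/-- Starting from a probing state, all the weight of `t` stays on probing states, since the ancilla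
state is preserved. The weight `v` serves sequential composition; constant weight serves
normalisation. -/
theorem Fam.probe_sum {A B : Sys} {t : Fam A B} (ht : t ∈ cone A B) (x : CPure (ontic A))
    (v : BPure (B ++ ancilla) → ℝ) :
    ∑ y : CPure (ontic B), v (probe y) * t ancilla (probe y) (probe x) =
      ∑ z, v z * t ancilla z (probe x) := by
  refine Fintype.sum_of_injective probe probe_injective _ _ (fun z hz => ?_) fun _ => rfl
  obtain ⟨x, b, rfl⟩ := BPure.lift_surj x
  rw [probe_lift, eq_zero_of_mem ht, mul_zero]
  rintro y s rfl
  exact hz ⟨y.lift s, probe_lift y s⟩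

theorem Fam.probe_sum_one {A B : Sys} {t : Fam A B} (ht : t ∈ cone A B) (x : CPure (ontic A)) :
    ∑ y : CPure (ontic B), t ancilla (probe y) (probe x) = ∑ z, t ancilla z (probe x) := by
  simpa using probe_sum ht x fun _ => 1

/-- In parallel with `C`, a transformation acts as it does on the ancilla, and preserves the ontic
state of `C`. -/
theorem Fam.probe_assoc {A B C : Sys} {t : Fam A B} (ht : t ∈ cone A B) (a : BPure A)
    (a' : BPure B) (c c' : BPure C) (s s' b b' : Bit) (h : C = [] → s = b) (h' : C = [] → s' = b') :
    t (C ++ ancilla) (a'.join (c'.join ancillaState (s' + b')) s')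
        (a.join (c.join ancillaState (s + b)) s) =
      t ancilla (a'.join ancillaState b') (a.join ancillaState b) *
        if c'.lift (b' + s') = c.lift (b + s) then 1 else 0 := by
  have hf : c'.lift (b' + s') = c.lift (b + s) ↔
      c'.join ancillaState (s' + b') = c.join ancillaState (s + b) := by
    rw [join_ancilla_iff, add_comm b', add_comm b]
  have hC : C ++ ancilla ≠ [] := by simp [ancilla_ne_nil]
  simp only [hf]
  induction ht using Submodule.span_induction with
  | mem t ht =>
    cases ht with
    | state z =>
      change (1 / 2) * ∑ r : Bit, (if a'.join (c'.join ancillaState (s' + b')) s' =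
          z.join (c.join ancillaState (s + b)) r then (1 : ℝ) else 0) =
        ((1 / 2) * ∑ r : Bit, if a'.join ancillaState b' = z.join ancillaState r then (1 : ℝ)
          else 0) * _
      by_cases hc : c'.join ancillaState (s' + b') = c.join ancillaState (s + b)
      · simp only [hc, BPure.join_eq_join_iff, hC, ancilla_ne_nil, false_or, true_and, if_true,
          mul_one]
        congr 1
        -- The bit is uniformly random, so the value depends neither on `s'` nor on `b'`: it is one
        -- half for non-trivial `B` and one for trivial `B`.
        by_cases ha : a' = z <;> by_cases hB : B = [] <;> simp [ha, hB]
      · simp [hc, BPure.join_eq_join_iff (e := c'.join ancillaState (s' + b'))]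
    | effect z =>
      rw [effect_join]
      change (if a = z ∧ c'.join ancillaState (s' + b') = c.join ancillaState (s + b)
        then (1 : ℝ) else 0) = effect z ancilla ancillaState (a.join ancillaState b) * _
      rw [effect_join]
      by_cases ha : a = z <;> simp [ha]
    | atomic z w τ =>
      rw [atomic_join, atomic_join]
      by_cases hc : c'.join ancillaState (s' + b') = c.join ancillaState (s + b)
      -- For non-trivial `C`, `hc` gives `s' + b' = s + b`, so `s` and `b` are flipped together or
      -- not at all; for trivial `C` they coincide by hypothesis.
      · have hs : s' = s + τ ↔ b' = b + τ := by
          rcases (BPure.join_inj hc).2.2 with h0 | h0 | h0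
          · rw [h h0, h' h0]
          · exact absurd h0 ancilla_ne_nil
          · clear h h' hf hc
            revert s s' b b' τ
            decide
        simp only [hc, BPure.join_eq_join_iff, hC, ancilla_ne_nil, hs]
        simp
      · simp [hc, BPure.join_eq_join_iff (e := c'.join ancillaState (s' + b'))]
  | zero => exact (zero_mul _).symm
  | add t u _ _ ht hu =>
    change t _ _ _ + u _ _ _ = (t _ _ _ + u _ _ _) * _
    rw [ht, hu, add_mul]
  | smul r t _ ht =>
    change r • t _ _ _ = (r • t _ _ _) * _
    rw [ht, smul_mul_assoc]

/-- Extends `BPure.assoc_join` to trivial systems. For trivial `C` only the bit shared with `E`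
survives on the left, which forces `s = b`; for trivial `A` the bit `s` must vanish unless `C` is
trivial. -/
theorem BPure.assoc_join_of {A C E : Sys} (a : BPure A) (c : BPure C) (e : BPure E) (s b : Bit)
    (hA : A = [] → C = [] ∨ s = 0) (hC : C = [] → s = b) :
    BPure.assoc A C E ((a.join c s).join e b) = a.join (c.join e (s + b)) s := by
  cases A with
  | nil =>
    change c.join e b = c.join e (s + b)
    rcases hA rfl with h | rfl
    · exact BPure.join_triv (Or.inl h) _ _ _ _
    · rw [zero_add]
  | cons n l =>
    cases C with
    | nil =>
      rw [hC rfl]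
      exact BPure.assoc_join_nil a e b b
    | cons m k => exact BPure.assoc_join a c e s b

/-- Every ontic state of `AC` arises from a pure state and a bit that are normalised where the
bits are redundant. -/
theorem lift_join_surj {A C : Sys} (w : CPure (ontic (A ++ C))) :
    ∃ (a : BPure A) (c : BPure C) (s b : Bit), (A = [] → C = [] ∨ s = 0) ∧ (C = [] → s = b) ∧
      w = (a.join c s).lift b := by
  obtain ⟨x, b, rfl⟩ := BPure.lift_surj w
  obtain ⟨a, c, s, hs, rfl⟩ := Fam.join_surj_zero x
  by_cases hC : C = []
  -- With `C` trivial the join ignores its bit, which may therefore be replaced by `b`.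
  · exact ⟨a, c, b, b, fun _ => Or.inl hC, fun _ => rfl, by
      rw [BPure.join_triv (Or.inr hC) a c s b]⟩
  · exact ⟨a, c, s, b, fun h => Or.inr (hs (Or.inl h)), fun h => absurd h hC, rfl⟩

/-! ### The model -/

/-- The ontic representation of a transformation. -/
def model (A B : Sys) (t : BTransf A B) : CTransf (ontic A) (ontic B) where
  mat y x := t.fam ancilla (probe y) (probe x)
  nonneg _ _ := Fam.nonneg_of_mem t.mem_cone _ _ _
  sum_le x := (Fam.probe_sum_one t.mem_cone x).trans_le (t.sub _ _)

theorem model_lift {A B : Sys} (t : BTransf A B) (y : BPure B) (x : BPure A) (b' b : Bit) :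
    (model A B t).mat (y.lift b') (x.lift b) =
      t.fam ancilla (y.join ancillaState b') (x.join ancillaState b) := by
  change t.fam ancilla (probe _) (probe _) = _
  rw [probe_lift, probe_lift]

theorem model_isLinear : (TheoryMap.ofFamily model).IsLinear := by
  intro A B X _ r t s h
  ext y x
  change s.fam ancilla (probe y) (probe x) = _
  rw [h]
  simp only [Finset.sum_apply, Matrix.sum_apply]
  rfl

/-- The weight in `Fam.probe_sum` is a row of `u`: intermediate pure states outside the range of
`probe` contribute nothing. -/
theorem model_comp {A B C : Sys} (u : BTransf B C) (t : BTransf A B) :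
    model A C (u.comp t) = (model B C u).comp (model A B t) := by
  ext y x
  exact (Fam.probe_sum t.mem_cone x fun z => u.fam ancilla (probe y) z).symm

theorem model_id (A : Sys) : model A A (BTransf.id A) = CTransf.id (ontic A) := by
  ext y x
  change (1 : Matrix (BPure (A ++ ancilla)) (BPure (A ++ ancilla)) ℝ) (probe y) (probe x) =
    (1 : Matrix (CPure (ontic A)) (CPure (ontic A)) ℝ) y x
  simp only [Matrix.one_apply, probe_injective.eq_iff]

/-! ### Swaps and parallel composition -/

/-- In `|(a b)_s;c)` the parts `a` and `b` carry the bits `c` and `c + s`. The swapped state `(b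
a)_s` has reference bit `c + s`, so `a` receives `c + s + s = c`: each part keeps its own bit. -/
theorem model_swap_mat (A B : Sys) (y : CPure (ontic (B ++ A))) (x : CPure (ontic (A ++ B))) :
    (model _ _ (BTransf.swap A B)).mat y x =
      if onticSplit B A y = (onticSplit A B x).swap then 1 else 0 := by
  obtain ⟨x, c, rfl⟩ := BPure.lift_surj x
  obtain ⟨y, c', rfl⟩ := BPure.lift_surj y
  obtain ⟨a, b, s, hs, rfl⟩ := Fam.join_surj_zero x
  rw [model_lift]
  have h : (onticSplit A B ((a.join b s).lift c)).swap =
      onticSplit B A ((b.join a s).lift (c + s)) := by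
    rw [onticSplit_join a b s c fun h => Or.inr (hs (Or.inl h)),
      onticSplit_join b a s (c + s) fun h => Or.inr (hs (Or.inr h)), add_assoc, bit_add_self,
      add_zero]
    rfl
  refine (Fam.swap_join a b s hs ancillaState c _).trans ?_
  simp only [h, (onticSplit B A).apply_eq_iff_eq, join_ancilla_iff]

/-- Parallel composition with an identity. -/
def BTransf.parId {A B : Sys} (t : BTransf A B) (C : Sys) : BTransf (A ++ C) (B ++ C) :=
  ⟨t.fam.parId C, Fam.parId_mem t.mem_cone C, Fam.parId_sub t.sub C⟩

theorem model_parId_mat {A B : Sys} (t : BTransf A B) (C : Sys) (y : CPure (ontic (B ++ C)))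
    (x : CPure (ontic (A ++ C))) :
    (model _ _ (t.parId C)).mat y x =
      (model A B t).mat (onticSplit B C y).1 (onticSplit A C x).1 *
        if (onticSplit B C y).2 = (onticSplit A C x).2 then 1 else 0 := by
  obtain ⟨a, c, s, b, hA, hC, rfl⟩ := lift_join_surj x
  obtain ⟨a', c', s', b', hB, hC', rfl⟩ := lift_join_surj y
  rw [model_lift, onticSplit_join a c s b hA, onticSplit_join a' c' s' b' hB, model_lift]
  change t.fam (C ++ ancilla) (BPure.assoc B C ancilla _) (BPure.assoc A C ancilla _) = _
  rw [BPure.assoc_join_of a c _ s b hA hC, BPure.assoc_join_of a' c' _ s' b' hB hC']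
  exact Fam.probe_assoc t.mem_cone a a' c c' s s' b b' hC hC'

theorem model_par_mat {A B C D : Sys} (t : BTransf A B) (u : BTransf C D)
    (y : CPure (ontic (B ++ D))) (x : CPure (ontic (A ++ C))) :
    (model _ _ (t.par u)).mat y x =
      (model A B t).mat (onticSplit B D y).1 (onticSplit A C x).1 *
        (model C D u).mat (onticSplit B D y).2 (onticSplit A C x).2 := by
  -- Swap followed by `u ⊠ I`; the swap is a permutation, so only one intermediate state
  -- contributes.
  have h1 : ∀ (v : CPure (ontic (D ++ B))) (z : CPure (ontic (B ++ C))),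
      (model _ _ ((u.parId B).comp (BTransf.swap B C))).mat v z =
        (model C D u).mat (onticSplit D B v).1 (onticSplit B C z).2 *
          if (onticSplit D B v).2 = (onticSplit B C z).1 then 1 else 0 := by
    intro v z
    rw [model_comp]
    change ∑ w, (model _ _ (u.parId B)).mat v w * (model _ _ (BTransf.swap B C)).mat w z = _
    rw [Finset.sum_eq_single ((onticSplit C B).symm (onticSplit B C z).swap)]
    · simp [model_swap_mat, model_parId_mat]
    · intro w _ hw
      rw [model_swap_mat, if_neg, mul_zero]
      exact fun h => hw ((onticSplit C B).eq_symm_apply.2 h)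
    · simp
  -- The second swap completes the conjugation, giving the entries of `I ⊠ u`.
  have h2 : ∀ (v : CPure (ontic (B ++ D))) (z : CPure (ontic (B ++ C))),
      (model _ _ ((BTransf.swap D B).comp ((u.parId B).comp (BTransf.swap B C)))).mat v z =
        (model C D u).mat (onticSplit B D v).2 (onticSplit B C z).2 *
          if (onticSplit B D v).1 = (onticSplit B C z).1 then 1 else 0 := by
    intro v z
    rw [model_comp]
    change ∑ w, (model _ _ (BTransf.swap D B)).mat v w * (model _ _ _).mat w z = _
    rw [Finset.sum_eq_single ((onticSplit D B).symm (onticSplit B D v).swap)]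
    · rw [model_swap_mat, h1]
      simp
    · intro w _ hw
      rw [model_swap_mat, if_neg, zero_mul]
      exact fun h => hw ((onticSplit D B).eq_symm_apply.2 (by rw [h, Prod.swap_swap]))
    · simp
  change (model _ _ (((BTransf.swap D B).comp ((u.parId B).comp (BTransf.swap B C))).comp
    (t.parId C))).mat y x = _
  rw [model_comp]
  change ∑ z, (model _ _ _).mat y z * (model _ _ (t.parId C)).mat z x = _
  -- Once `t` has acted and `u` has not, the `B` part already has its final value and the `C` part
  -- still has its initial one.
  rw [Finset.sum_eq_single ((onticSplit B C).symm ((onticSplit B D y).1, (onticSplit A C x).2))]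
  · rw [h2, model_parId_mat, Equiv.apply_symm_apply, if_pos rfl, if_pos rfl, mul_one, mul_one,
      mul_comm]
  · intro z _ hz
    rw [h2, model_parId_mat]
    by_cases ha : (onticSplit B D y).1 = (onticSplit B C z).1
    · rw [if_neg (c := _ = (onticSplit A C x).2), mul_zero, mul_zero]
      exact fun hc => hz ((onticSplit B C).eq_symm_apply.2 (Prod.ext ha.symm hc))
    · rw [if_neg ha, mul_zero, zero_mul]
  · exact fun h => absurd (Finset.mem_univ _) h

theorem model_isDiagramPreserving : (TheoryMap.ofFamily model).IsDiagramPreserving where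
  obj_append := ontic_append
  map_comp _ _ _ u t := model_comp u t
  map_id := model_id
  map_par A B C D t u := by
    ext y x
    refine (CTransf.cast_onticSplit (model _ _ (t.par u)) y x).trans ?_
    rw [model_par_mat]
    simp only [Equiv.apply_symm_apply]
    rfl
  map_swap A B := by
    ext y x
    refine (CTransf.cast_onticSplit (model _ _ (BTransf.swap A B)) y x).trans ?_
    rw [model_swap_mat]
    simp only [Equiv.apply_symm_apply]
    rfl

/-! ### Scalars, instruments and deterministic effects -/

/-- Needed because `prob` evaluates a scalar without ancilla, whereas the model evaluates it at the
probing ancilla. -/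
theorem Fam.scalar_eq {t : Fam [] []} (ht : t ∈ cone [] []) {E : Sys} (e : BPure E) :
    t E e e = t [] () () := by
  induction ht using Submodule.span_induction with
  | mem t ht =>
    cases ht with
    | state z =>
      change (1 / 2) * ∑ r : Bit, (if e = e then (1 : ℝ) else 0) =
        (1 / 2) * ∑ r : Bit, (if () = () then (1 : ℝ) else 0)
      simp
    | effect z =>
      have h := effect_join z () e 0 e
      have h' := effect_join z () (E := []) () 0 ()
      refine h.trans (Eq.trans ?_ h'.symm)
      rw [if_pos ⟨rfl, rfl⟩, if_pos ⟨rfl, rfl⟩]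
  | zero => rfl
  | add t u _ _ ht hu =>
    change t _ _ _ + u _ _ _ = t _ _ _ + u _ _ _
    rw [ht, hu]
  | smul r t _ ht =>
    change r • t _ _ _ = r • t _ _ _
    rw [ht]

theorem probe_nil (w : CPure (ontic [])) : probe w = (ancillaState : BPure ([] ++ ancilla)) :=
  probe_lift (A := []) () 0

theorem model_isProbabilityPreserving : (TheoryMap.ofFamily model).IsProbabilityPreserving := by
  intro p
  change p.fam ancilla (probe (A := []) ()) (probe (A := []) ()) = p.fam [] () ()
  exact (congrArg₂ (p.fam ancilla) (probe_nil ()) (probe_nil ())).trans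
    (Fam.scalar_eq p.mem_cone ancillaState)

theorem Fam.sum_discard (A : Sys) {E : Sys} (x : BPure (A ++ E)) :
    ∑ y, discard A E y x = 1 := by
  obtain ⟨a, e, s, rfl⟩ := BPure.join_surj x
  change ∑ y : BPure E, _ = _
  simp [discard_join]

theorem model_preservesInstruments : (TheoryMap.ofFamily model).PreservesInstruments := by
  intro A B X _ t ht x
  have hmem : ∑ k, (t k).fam ∈ Fam.cone A B := Submodule.sum_mem _ fun k _ => (t k).mem_cone
  have h1 : ∑ y, (∑ k, (model A B (t k)).mat) y x =
      ∑ y : CPure (ontic B), (∑ k, (t k).fam) ancilla (probe y) (probe x) := by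
    refine Finset.sum_congr rfl fun y _ => ?_
    refine (Matrix.sum_apply _ _ _ _).trans ?_
    simp only [Finset.sum_apply, Matrix.sum_apply]
    rfl
  have h2 := Fam.sum_discard A (E := ancilla) (probe x)
  rw [← ht] at h2
  refine h1.trans ((Fam.probe_sum_one hmem x).trans (Eq.trans ?_ h2))
  -- All column sums of `discard` are one, so composing with it leaves the column sums unchanged.
  change _ = ∑ y : BPure ([] ++ ancilla), ∑ z, Fam.discard B ancilla y z * _
  rw [Finset.sum_comm]
  simp only [← Finset.sum_mul, Fam.sum_discard, one_mul]

theorem Fam.discard_nil : discard [] = id [] := by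
  refine ext_join fun E y a e s => ?_
  rw [discard_join]
  exact (Matrix.one_apply (n := BPure E) (i := y) (j := e)).symm

/-- Discarding the trivial system is the identity, so a deterministic effect is `discard` itself,
whose probed entries are all one. -/
theorem model_preservesDeterministicEffects :
    (TheoryMap.ofFamily model).PreservesDeterministicEffects := by
  intro A e he
  have h : (Fam.discard []).comp e.fam = Fam.discard A := congrArg BTransf.fam he
  have h' : (Fam.id []).comp e.fam = e.fam := by
    funext E
    exact Matrix.one_mul (e.fam E)
  rw [Fam.discard_nil, h'] at h
  ext y x
  change e.fam ancilla (probe (A := []) y) (probe x) = 1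
  obtain ⟨x, b, rfl⟩ := BPure.lift_surj x
  exact (congrArg₂ (e.fam ancilla) (probe_nil y) (probe_lift x b)).trans
    (by rw [h, Fam.discard_join, if_pos rfl])

/-! ### Values on generators and uniqueness -/

theorem model_isStandardModel : IsStandardModel model where
  state B y y' z := by
    obtain ⟨y', b, rfl⟩ := BPure.lift_surj y'
    change Fam.state y ancilla (probe _) (probe (A := []) z) = _
    rw [probe_lift, probe_nil]
    simp only [Fam.state, join_ancilla_iff]
  effect A x x' z := by
    obtain ⟨x', b, rfl⟩ := BPure.lift_surj x'
    change Fam.effect x ancilla (probe (A := []) z) (probe _) = _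
    rw [probe_lift, probe_nil, Fam.effect_join]
    congr 1
    refine propext ⟨?_, ?_⟩
    · rintro ⟨rfl, -⟩
      exact ⟨b, rfl⟩
    · rintro ⟨c, h⟩
      exact ⟨(BPure.lift_inj h).1, rfl⟩
  atomic n m l k x y τ y' x' := by
    obtain ⟨x', b, rfl⟩ := BPure.lift_surj x'
    obtain ⟨y', b', rfl⟩ := BPure.lift_surj y'
    rw [model_lift]
    change Fam.atomic x y τ ancilla _ _ = _
    rw [Fam.atomic_join]
    congr 1
    rw [join_ancilla_iff]
    refine propext ⟨?_, ?_⟩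
    · rintro ⟨rfl, h⟩
      exact ⟨b, rfl, h⟩
    · rintro ⟨c, h, h'⟩
      obtain ⟨rfl, h0 | rfl⟩ := BPure.lift_inj h
      · cases h0
      · exact ⟨rfl, h'⟩
  one := model_id []

/-- A standard model is determined on generators. -/
theorem IsStandardModel.eq_on_generator
    {f g : (A B : Sys) → BTransf A B → CTransf (ontic A) (ontic B)} (hf : IsStandardModel f)
    (hg : IsStandardModel g) {A B : Sys} {t : Fam A B} (ht : Fam.IsGenerator A B t)
    (s : BTransf A B) (hs : s.fam = t) : f A B s = g A B s := by
  cases ht with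
  | state y =>
    obtain rfl : s = BTransf.state y := BTransf.ext hs
    ext y' z
    rw [hf.state, hg.state]
  | effect x =>
    obtain rfl : s = BTransf.effect x := BTransf.ext hs
    ext z x'
    rw [hf.effect, hg.effect]
  | atomic x y τ =>
    obtain rfl : s = BTransf.atomic x y τ := BTransf.ext hs
    ext y' x'
    rw [hf.atomic, hg.atomic]

theorem Fam.IsGenerator.exists_transf {A B : Sys} {t : Fam A B} (ht : IsGenerator A B t) :
    ∃ s : BTransf A B, s.fam = t := by
  cases ht with
  | state y => exact ⟨BTransf.state y, rfl⟩
  | effect x => exact ⟨BTransf.effect x, rfl⟩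
  | atomic x y τ => exact ⟨BTransf.atomic x y τ, rfl⟩

/-- Linearity is only available for combinations of transformations; it applies to a conical
decomposition of `t` because each generator is subnormalised (`Fam.IsGenerator.exists_transf`) and
the total is `t`. -/
theorem IsStandardModel.unique
    {f g : (A B : Sys) → BTransf A B → CTransf (ontic A) (ontic B)}
    (hf : IsStandardModel f) (hg : IsStandardModel g) (lf : (TheoryMap.ofFamily f).IsLinear)
    (lg : (TheoryMap.ofFamily g).IsLinear) : f = g := by
  funext A B t
  obtain ⟨n, r, v, h⟩ := Submodule.mem_span_set'.1 t.mem_cone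
  choose s hs using fun i => (v i).2.exists_transf
  have ht : t.fam = ∑ i, (r i : ℝ) • (s i).fam := by
    simp only [← h, hs]
    rfl
  refine CTransf.ext ((lf A B (Fin n) _ s t ht).trans (Eq.trans ?_ (lg A B (Fin n) _ s t ht).symm))
  refine Finset.sum_congr rfl fun i _ => ?_
  exact congrArg (fun w : CTransf (ontic A) (ontic B) => (r i : ℝ) • w.mat)
    (hf.eq_on_generator hg (v i).2 (s i) (hs i))

end BilocalClassical

end

theorem theorem1 :
    ∃ f : (A B : BilocalClassical.Sys) → BilocalClassical.BTransf A B →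
        BilocalClassical.CTransf (BilocalClassical.ontic A) (BilocalClassical.ontic B),
      (BilocalClassical.TheoryMap.ofFamily f).IsLinear ∧
      BilocalClassical.IsStandardModel f ∧
      (∀ g : (A B : BilocalClassical.Sys) → BilocalClassical.BTransf A B →
          BilocalClassical.CTransf (BilocalClassical.ontic A) (BilocalClassical.ontic B),
        (BilocalClassical.TheoryMap.ofFamily g).IsLinear →
          BilocalClassical.IsStandardModel g → g = f) ∧
      (BilocalClassical.TheoryMap.ofFamily f).IsOntologicalModel ∧
      (BilocalClassical.TheoryMap.ofFamily f).PreservesDeterministicEffects := by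
  open BilocalClassical in
  exact ⟨model, model_isLinear, model_isStandardModel,
    fun g lg hg => hg.unique model_isStandardModel lg model_isLinear,
    ⟨model_isLinear, model_isDiagramPreserving, model_isProbabilityPreserving,
      model_preservesInstruments⟩, model_preservesDeterministicEffects⟩
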